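/- Let $K$ be a commutative unital ring and $G$ a group. Let $\mathcal A=\prod_{\lambda\in\Lambda}\mathcal A_\lambda$ be a direct product of (not necessarily commutative) indecomposable unital $K$-algebras, i.e. each $\mathcal A_\lambda$ is nonzero and has no central idempotents other than $0$ and $1$. Let $\alpha=\{\alpha_g:\mathcal D_{g^{-1}}\to\mathcal D_g\mid g\in G\}$ be a unital partial action of $G$ on $\mathcal A$: each $\mathcal D_g=1_g\mathcal A$ is an ideal generated by a central idempotent $1_g$, the $\alpha_g$ are algebra isomorphisms, $\alpha_1=\mathrm{id}_{\mathcal A}$, and whenever $\alpha_h(a)$ and $\alpha_g(\alpha_h(a))$ are defined, so is $\alpha_{gh}(a)$, and $\alpha_g(\alpha_h(a))=\alpha_{gh}(a)$. Put $1_{(g_1,\dots,g_n)}=1_{g_1}1_{g_1g_2}\cdots1_{g_1\cdots g_n}$, let $C^n_{par}(G,\mathcal A)$ be the set of all $f:G^n\to\mathcal A$ with $f(g_1,\dots,g_n)\in1_{(g_1,\dots,g_n)}\mathcal A$ (so $C^0_{par}(G,\mathcal A)=\mathcal A$), and for $n\ge 0$ define $\delta^n:C^n_{par}(G,\mathcal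 A)\to C^{n+1}_{par}(G,\mathcal A)$ by $$(\delta^nf)(g_1,\dots,g_{n+1})=\alpha_{g_1}\bigl(1_{g_1^{-1}}f(g_2,\dots,g_{n+1})\bigr)+\sum_{i=1}^n(-1)^i1_{g_1\cdots g_i}f(g_1,\dots,g_ig_{i+1},\dots,g_{n+1})+(-1)^{n+1}1_{g_1\cdots g_{n+1}}f(g_1,\dots,g_n).$$ Let $Z^n_{par}(G,\mathcal A)=\ker\delta^n$; two elements of it, $n>0$, are cohomologous if they differ by an element of $\operatorname{im}\delta^{n-1}$. Let $(\mathcal B,\beta)$ be an enveloping action of $\alpha$: $\mathcal B$ is a (not necessarily unital) $K$-algebra with an action $\beta$ of $G$ by algebra automorphisms, together with an injective algebra homomorphism $\varphi:\mathcal A\to\mathcal B$ such that $\varphi(\mathcal A)$ is a two-sided ideal of $\mathcal B$, $\varphi(\mathcal D_g)=\varphi(\mathcal A)\cap\beta_g(\varphi(\mathcal A))$, $\varphi\circ\alpha_g=\beta_g\circ\varphi$ on $\mathcal D_{g^{-1}}$ for all $g\in G$, and the algebra $\mathcal B$ is generated by $\bigcup_{g\in G}\beta_g(\varphi(\mathcal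 A))$. Let $\mathcal M(\mathcal B)$ be the multiplier algebra of $\mathcal B$, that is, the set of pairs $u=(R,L)$ of an endomorphism $R$ of the left $\mathcal B$-module $\mathcal B$ and an endomorphism $L$ of the right $\mathcal B$-module $\mathcal B$ with $(aR)b=a(Lb)$ for all $a,b\in\mathcal B$; write $bu=bR$, and let $G$ act on $\mathcal M(\mathcal B)$ by $\beta^*_g(u)=\beta_gu\beta_g^{-1}$ (componentwise). Let $Z^n(G,\mathcal M(\mathcal B))$ be the classical $n$-cocycles of $G$ with values in the additive group of $\mathcal M(\mathcal B)$ with this action. A globalization of $w\in Z^n_{par}(G,\mathcal A)$ is a $u\in Z^n(G,\mathcal M(\mathcal B))$ with $$\varphi(w(g_1,\dots,g_n))=\varphi(1_{(g_1,\dots,g_n)})\,u(g_1,\dots,g_n)\quad\text{for all }g_1,\dots,g_n\in G.$$ Theorem. Let $n>0$, let $w_1,w_2\in Z^n_{par}(G,\mathcal A)$, and let $u_i\in Z^n(G,\mathcal M(\mathcal B))$ be a globalization of $w_i$, $i=1,2$. If $w_1$ is cohomologous to $w_2$, then $u_1$ is cohomologous to $u_2$. In particular, any two globalizations of the same $w\in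 Z^n_{par}(G,\mathcal A)$ are cohomologous. -/

import Mathlib

/-- A partial action of a group `G` on a (not necessarily unital) `K`-algebra `A`: two-sided ideals
`D g` and algebra isomorphisms `act g : D g⁻¹ ≃ D g` such that `act 1` is the identity of `A`, and
whenever `act h a` and `act g (act h a)` are defined, so is `act (g * h) a`, and the two agree. -/
structure PartialAction (K G A : Type*) [CommRing K] [Group G] [NonUnitalRing A] [Module K A] where
  /-- the domains -/
  D : G → Submodule K A
  mul_mem_left : ∀ (g : G) (b : A) {a : A}, a ∈ D g → b * a ∈ D g
  mul_mem_right : ∀ (g : G) (b : A) {a : A}, a ∈ D g → a * b ∈ D g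
  /-- the partial isomorphisms -/
  act : ∀ g : G, D g⁻¹ ≃ₗ[K] D g
  map_mul : ∀ (g : G) (a b : D g⁻¹),
    (act g ⟨a * b, mul_mem_left g⁻¹ a b.2⟩ : A) = act g a * act g b
  D_one : D 1 = ⊤
  act_one : ∀ a : D (1 : G)⁻¹, (act 1 a : A) = a
  act_act : ∀ (g h : G) (a : D h⁻¹) (ha : (act h a : A) ∈ D g⁻¹),
    ∃ ha' : (a : A) ∈ D (g * h)⁻¹, (act (g * h) ⟨a, ha'⟩ : A) = act g ⟨act h a, ha⟩

/-- A unital partial action on a unital algebra: every domain is `D g = 1_g A` for a central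
idempotent `1_g`, here written `e g`. -/
structure UnitalPartialAction (K G A : Type*) [CommRing K] [Group G] [Ring A] [Algebra K A] extends
    PartialAction K G A where
  /-- the identity element of the ideal `D g` -/
  e : G → A
  e_idem : ∀ g, e g * e g = e g
  e_comm : ∀ g a, e g * a = a * e g
  mem_D_iff : ∀ g a, a ∈ D g ↔ ∃ b, a = e g * b

namespace UnitalPartialAction

variable {K G A : Type*} [CommRing K] [Group G] [Ring A] [Algebra K A]

/-- The action `[g] · a = α_g(1_{g⁻¹} a)` of the generators of the partial group algebra of `G`
on `A`. -/
def bracket (α : UnitalPartialAction K G A) (g : G) (a : A) : A :=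
  α.act g ⟨α.e g⁻¹ * a, (α.mem_D_iff g⁻¹ _).2 ⟨a, rfl⟩⟩

/-- The element `[g][g⁻¹]` of the partial group algebra acts on `A` as multiplication by `1_g`. -/
theorem bracket_bracket_inv (α : UnitalPartialAction K G A) (g : G) (a : A) :
    α.bracket g (α.bracket g⁻¹ a) = α.e g * a := by
  have h1 : ∀ x ∈ α.D g⁻¹, α.e g⁻¹ * x = x := by
    intro x hx
    obtain ⟨b, rfl⟩ := (α.mem_D_iff _ _).1 hx
    rw [← mul_assoc, α.e_idem]
  have hm : α.bracket g⁻¹ a ∈ α.D g⁻¹ := Subtype.property _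
  obtain ⟨ha', h⟩ := α.act_act g g⁻¹ ⟨α.e g⁻¹⁻¹ * a, (α.mem_D_iff _ _).2 ⟨a, rfl⟩⟩ hm
  have key : ∀ (k : G) (hk : k = 1) (x : A) (hx : x ∈ α.D k⁻¹), (α.act k ⟨x, hx⟩ : A) = x := by
    rintro k rfl x hx
    exact α.act_one ⟨x, hx⟩
  rw [key _ (mul_inv_cancel g)] at h
  refine Eq.trans ?_ ((congrArg (fun k => α.e k * a) (inv_inv g)).symm.trans h).symm
  unfold bracket
  congr 2
  exact Subtype.ext (h1 _ hm)

/-- The idempotent `1_{(g₁,…,gₙ)} = 1_{g₁} 1_{g₁g₂} ⋯ 1_{g₁⋯gₙ}` (equal to `1` for `n = 0`). -/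
def eTuple (α : UnitalPartialAction K G A) {n : ℕ} (x : Fin n → G) : A :=
  (List.ofFn fun i : Fin n => α.e (Fin.partialProd x i.succ)).prod

/-- The partial cochains `C^n_par(G, A)`: functions `f` on `Gⁿ` with
`f(g₁,…,gₙ) ∈ 1_{(g₁,…,gₙ)} A`. -/
def IsCochain (α : UnitalPartialAction K G A) {n : ℕ} (f : (Fin n → G) → A) : Prop :=
  ∀ x, ∃ a, f x = α.eTuple x * a

/-- The partial coboundary operator
`(δf)(g₁,…,gₙ₊₁) = α_{g₁}(1_{g₁⁻¹} f(g₂,…,gₙ₊₁)) + ∑ᵢ (-1)ⁱ 1_{g₁⋯gᵢ} f(g₁,…,gᵢgᵢ₊₁,…,gₙ₊₁)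
  + (-1)ⁿ⁺¹ 1_{g₁⋯gₙ₊₁} f(g₁,…,gₙ)`.
The index `j` below is `i - 1`, and `j = n` gives the last summand. -/
def delta (α : UnitalPartialAction K G A) (n : ℕ) (f : (Fin n → G) → A) (x : Fin (n + 1) → G) : A :=
  α.bracket (x 0) (f fun i => x i.succ) +
    ∑ j : Fin (n + 1), (-1 : ℤ) ^ ((j : ℕ) + 1) •
      (α.e (Fin.partialProd x j.succ) * f (Fin.contractNth j (· * ·) x))

/-- The partial cocycles `Z^n_par(G, A)`. -/
def IsCocycle (α : UnitalPartialAction K G A) {n : ℕ} (w : (Fin n → G) → A) : Prop :=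
  α.IsCochain w ∧ α.delta n w = 0

/-- Two partial `(n+1)`-cochains are cohomologous if they differ by a partial coboundary. -/
def Cohomologous (α : UnitalPartialAction K G A) {n : ℕ} (w₁ w₂ : (Fin (n + 1) → G) → A) : Prop :=
  ∃ ξ : (Fin n → G) → A, α.IsCochain ξ ∧ w₂ = w₁ + α.delta n ξ

end UnitalPartialAction

/-- A (global) action of `G` on a `K`-algebra `B` by algebra automorphisms. -/
structure GlobalAction (K G B : Type*) [CommRing K] [Group G] [NonUnitalRing B] [Module K B] where
  /-- the action by linear automorphisms -/
  act : G →* (B ≃ₗ[K] B)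
  map_mul : ∀ (g : G) (a b : B), act g (a * b) = act g a * act g b

/-- `(B, β)` is an enveloping action of the partial action `α` on `A` by means of `φ : A → B`:
`φ` is an isomorphism of `A` onto a two-sided ideal of `B`, `α` becomes the restriction of `β` to
this ideal, and the algebra `B` is generated by the translates of the ideal. -/
structure IsEnvelopingAction {K G A B : Type*} [CommRing K] [Group G]
    [NonUnitalRing A] [Module K A] [NonUnitalRing B] [Module K B]
    [IsScalarTower K B B] [SMulCommClass K B B]
    (α : PartialAction K G A) (β : GlobalAction K G B) (φ : A →ₙₐ[K] B) : Prop where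
  injective : Function.Injective φ
  mul_mem_left : ∀ (b : B) (a : A), b * φ a ∈ Set.range φ
  mul_mem_right : ∀ (a : A) (b : B), φ a * b ∈ Set.range φ
  image_D : ∀ g : G, φ '' (α.D g : Set A) = Set.range φ ∩ β.act g '' Set.range φ
  map_act : ∀ (g : G) (a : α.D g⁻¹), φ (α.act g a) = β.act g (φ a)
  generates : NonUnitalAlgebra.adjoin K (⋃ g : G, β.act g '' Set.range φ) = ⊤

/-- The multipliers `(R, L)` of an algebra `B`, as a submodule of `End_K B × End_K B`: `R` is an
endomorphism of the left `B`-module `B`, `L` is an endomorphism of the right `B`-module `B`, and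
`(aR)b = a(Lb)`. -/
def Multiplier (K B : Type*) [CommRing K] [NonUnitalRing B] [Module K B]
    [IsScalarTower K B B] [SMulCommClass K B B] : Submodule K ((B →ₗ[K] B) × (B →ₗ[K] B)) where
  carrier := {u | (∀ a b, u.1 (a * b) = a * u.1 b) ∧ (∀ a b, u.2 (a * b) = u.2 a * b) ∧
    ∀ a b, u.1 a * b = a * u.2 b}
  add_mem' := by
    rintro u v ⟨h1, h2, h3⟩ ⟨k1, k2, k3⟩
    refine ⟨fun a b => ?_, fun a b => ?_, fun a b => ?_⟩
    · simp [h1, k1, mul_add]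
    · simp [h2, k2, add_mul]
    · simp [h3, k3, mul_add, add_mul]
  zero_mem' := by simp
  smul_mem' := by
    rintro c u ⟨h1, h2, h3⟩
    refine ⟨fun a b => ?_, fun a b => ?_, fun a b => ?_⟩
    · simp [h1, mul_smul_comm]
    · simp [h2, smul_mul_assoc]
    · simp [h3, smul_mul_assoc, mul_smul_comm]

namespace GlobalAction

variable {K G B : Type*} [CommRing K] [Group G] [NonUnitalRing B] [Module K B]
  [IsScalarTower K B B] [SMulCommClass K B B]

/-- The induced action `β*_g(u) = β_g u β_g⁻¹` of `G` on the multipliers of `B`. -/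
def multiplierRep (β : GlobalAction K G B) : Representation K G (Multiplier K B) where
  toFun g :=
    { toFun := fun u => ⟨((β.act g).conj u.1.1, (β.act g).conj u.1.2), by
        have hs : ∀ a b : B, (β.act g).symm (a * b) = (β.act g).symm a * (β.act g).symm b := by
          intro a b
          apply (β.act g).injective
          simp [β.map_mul]
        obtain ⟨⟨R, L⟩, h1, h2, h3⟩ := u
        refine ⟨fun a b => ?_, fun a b => ?_, fun a b => ?_⟩
        · simpa [LinearEquiv.conj_apply, hs, β.map_mul] using congrArg (β.act g)
            (h1 ((β.act g).symm a) ((β.act g).symm b))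
        · simpa [LinearEquiv.conj_apply, hs, β.map_mul] using congrArg (β.act g)
            (h2 ((β.act g).symm a) ((β.act g).symm b))
        · simpa [LinearEquiv.conj_apply, hs, β.map_mul] using congrArg (β.act g)
            (h3 ((β.act g).symm a) ((β.act g).symm b))⟩
      map_add' := fun u v => by ext <;> simp [LinearEquiv.conj_apply]
      map_smul' := fun c u => by ext <;> simp [LinearEquiv.conj_apply] }
  map_one' := by ext <;> simp [LinearEquiv.conj_apply] <;> rfl
  map_mul' g h := by
    ext <;> simp [LinearEquiv.conj_apply] <;> rfl

end GlobalAction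

namespace Representation

variable {K G M : Type*} [CommRing K] [Group G] [AddCommGroup M] [Module K M]

/-- The classical coboundary operator on inhomogeneous cochains of `G` with values in a
`G`-module. -/
def delta (ρ : Representation K G M) (n : ℕ) (f : (Fin n → G) → M) (x : Fin (n + 1) → G) : M :=
  ρ (x 0) (f fun i => x i.succ) +
    ∑ j : Fin (n + 1), (-1 : ℤ) ^ ((j : ℕ) + 1) • f (Fin.contractNth j (· * ·) x)

/-- The coboundary operator above is the one that computes Mathlib's group cohomology. -/
theorem delta_eq_inhomogeneousCochains_d.{u} {K G M : Type u} [CommRing K] [Group G] [AddCommGroup M]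
    [Module K M] (ρ : Representation K G M) (n : ℕ) (f : (Fin n → G) → M) :
    ρ.delta n f =
      inhomogeneousCochains.d (Rep.of ρ) n f := by
  funext x
  simp [delta, inhomogeneousCochains.d_hom_apply, ← Int.cast_smul_eq_zsmul K]

/-- The cocycles `Z^n(G, M)`. -/
def IsCocycle (ρ : Representation K G M) {n : ℕ} (u : (Fin n → G) → M) : Prop :=
  ρ.delta n u = 0

/-- Two `(n+1)`-cochains are cohomologous if they differ by a coboundary. -/
def Cohomologous (ρ : Representation K G M) {n : ℕ} (u₁ u₂ : (Fin (n + 1) → G) → M) : Prop :=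
  ∃ ξ : (Fin n → G) → M, u₂ = u₁ + ρ.delta n ξ

end Representation

/-- `u ∈ Z^n(G, M(B))` is a globalization of `w : Gⁿ → A`, that is,
`φ(w(g₁,…,gₙ)) = φ(1_{(g₁,…,gₙ)}) u(g₁,…,gₙ)`, where `b u` is `b` transformed by the first component
of the multiplier `u`. -/
def IsGlobalization {K G A B : Type*} [CommRing K] [Group G] [Ring A] [Algebra K A]
    [NonUnitalRing B] [Module K B] [IsScalarTower K B B] [SMulCommClass K B B]
    (α : UnitalPartialAction K G A) (β : GlobalAction K G B) (φ : A →ₙₐ[K] B) {n : ℕ}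
    (w : (Fin n → G) → A) (u : (Fin n → G) → Multiplier K B) : Prop :=
  β.multiplierRep.IsCocycle u ∧ ∀ x, φ (w x) = (u x).1.1 (φ (α.eTuple x))

/-- A ring is indecomposable if it is nonzero and `0`, `1` are its only central idempotents, that
is, it is not a product of two nonzero rings. -/
def IsIndecomposableRing (R : Type*) [Ring R] : Prop :=
  Nontrivial R ∧ ∀ e : R, e * e = e → (∀ a, e * a = a * e) → e = 0 ∨ e = 1

/-! The difference `u` of two globalizations of cohomologous cocycles restricts on `A` to a partial
coboundary `δξ`, and `u` must be shown to be a classical coboundary.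

A multiplier `v` of `B` is determined by the restrictions to `A` of all its translates, and a family
`a : G → A` arises in this way as soon as `[g] a(k) = 1_g a(gk)` (`multiplier_ext`,
`exists_multiplier`). Classical cochains with values in multipliers therefore become `A`-valued
homogeneous cochains that are equivariant in the partial sense. In this language `u` is a
homogeneous cocycle `f`, and `ξ` yields an equivariant `X`. At the factor `k` the equation `f = dX`
is available only on tuples with all entries in `supp k`, where the idempotents involved equal `1`.

To remove this restriction, let `ρ_k : G → supp k` be a map of sets. On the factor `k` the prism
operator `P` satisfies `f ∘ ρ_k - f = P(df) + d(Pf) = d(Pf)`, while `f ∘ ρ_k = d(X ∘ ρ_k)`. Hence `Y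
= X ∘ ρ_k - Pf` (`transfer`) satisfies `dY = f` everywhere.

It remains to make `Y` equivariant. Indecomposability is needed here: a partial action permutes the
factors wherever it is defined (`exists_bracket_apply_eq`), so the sets `supp k` are translates of
each other along orbits, and the `ρ_k` can be chosen compatibly with these translations
(`retraction_mul`). Then `Y` comes from a cochain of multipliers with coboundary `u`. -/

/-! ### Simplicial cochains on lists and the prism homotopy. -/

section ListCochains

variable {X Y M N : Type*} [AddCommGroup M] [AddCommGroup N]

/-- The coboundary `(df)(x₀, …, xₙ) = ∑ (-1)ⁱ f(x₀, …, x̂ᵢ, …, xₙ)` on functions of lists. -/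
def listD : (List X → M) → List X → M
  | _, [] => 0
  | f, x :: l => f l - listD (fun l' => f (x :: l')) l

/-- The prism operator of the homotopy between the identity and the map induced by `ρ`. -/
def listPrism (ρ : X → X) : (List X → M) → List X → M
  | _, [] => 0
  | f, x :: l => f (x :: (x :: l).map ρ) - listPrism ρ (fun l' => f (x :: l')) l

theorem listD_sub (f g : List X → M) (l : List X) :
    listD (fun l => f l - g l) l = listD f l - listD g l := by
  induction l generalizing f g with
  | nil => simp [listD]
  | cons x l ih => simp only [listD, ih]; abel

theorem map_listD (θ : M →+ N) (f : List X → M) (l : List X) :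
    θ (listD f l) = listD (fun l => θ (f l)) l := by
  induction l generalizing f with
  | nil => simp [listD]
  | cons x l ih => simp only [listD, ih, map_sub]

theorem listD_map (ρ : X → Y) (f : List Y → M) (l : List X) :
    listD f (l.map ρ) = listD (fun l => f (l.map ρ)) l := by
  induction l generalizing f with
  | nil => simp [listD]
  | cons x l ih => simp only [listD, List.map_cons, ih]

theorem listPrism_sub (ρ : X → X) (f g : List X → M) (l : List X) :
    listPrism ρ (fun l => f l - g l) l = listPrism ρ f l - listPrism ρ g l := by
  induction l generalizing f g with
  | nil => simp [listPrism]
  | cons x l ih => simp only [listPrism, ih]; abel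

theorem map_listPrism (ρ : X → X) (θ : M →+ N) (f : List X → M) (l : List X) :
    θ (listPrism ρ f l) = listPrism ρ (fun l => θ (f l)) l := by
  induction l generalizing f with
  | nil => simp [listPrism]
  | cons x l ih => simp only [listPrism, ih, map_sub]

theorem listPrism_map (ρ : X → X) (ρ' : Y → Y) (t : X → Y) (h : ∀ x, ρ' (t x) = t (ρ x))
    (f : List Y → M) (l : List X) :
    listPrism ρ' f (l.map t) = listPrism ρ (fun l => f (l.map t)) l := by
  induction l generalizing f with
  | nil => simp [listPrism]
  | cons x l ih =>
    have : ρ' ∘ t = t ∘ ρ := funext h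
    simp only [listPrism, List.map_cons, ih, List.map_map, h, this]

theorem listPrism_eq_zero (ρ : X → X) (m : ℕ) (f : List X → M)
    (hf : ∀ l, l.length = m + 1 → f l = 0) (l : List X) (hl : l.length = m) :
    listPrism ρ f l = 0 := by
  induction l generalizing f m with
  | nil => rfl
  | cons x l ih =>
    subst hl
    rw [listPrism, hf _ (by simp), ih l.length _ (fun l' hl' => hf _ (by simp [hl'])) rfl, sub_zero]

/-- The homotopy formula for the prism operator. -/
theorem listPrism_listD_add (ρ : X → X) (f : List X → M) (l : List X) :
    listPrism ρ (listD f) l + listD (listPrism ρ f) l = f (l.map ρ) - f l := by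
  induction l generalizing f with
  | nil => simp [listPrism, listD]
  | cons x l ih =>
    -- Expanding both operators at the head leaves terms in the cochain `f (x :: ·)`, to which the
    -- induction hypothesis applies; the faces of `x :: ρ x :: l.map ρ` cancel between `h1` and
    -- `h2`.
    have h1 : listPrism ρ (listD f) (x :: l) = f ((x :: l).map ρ)
        - (f (x :: l.map ρ) - listD (fun l' => f (x :: ρ x :: l')) (l.map ρ))
        - (listPrism ρ f l - listPrism ρ (listD fun l' => f (x :: l')) l) := by
      rw [← listPrism_sub]
      simp only [listPrism, listD, List.map_cons]
    have h2 : listD (listPrism ρ f) (x :: l) = listPrism ρ f l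
        - (listD (fun l' => f (x :: ρ x :: l'.map ρ)) l
          - listD (listPrism ρ fun l' => f (x :: l')) l) := by
      rw [← listD_sub]
      simp only [listPrism, listD, List.map_cons]
    have h3 := ih (fun l' => f (x :: l'))
    rw [h1, h2, listD_map]
    rw [← eq_sub_iff_add_eq] at h3
    rw [h3]
    abel

end ListCochains

/-! ### Passage between inhomogeneous and homogeneous arguments. -/

section Bar

variable {G M : Type*} [Group G] [AddCommGroup M]

/-- The alternating sum of the faces of an inhomogeneous cochain other than the first one. -/
def barSum : (List G → M) → List G → M
  | _, [] => 0
  | f, [_] => f []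
  | f, g :: h :: l => f (g * h :: l) - barSum (fun l' => f (g :: l')) (h :: l)

/-- The quotients `x⁻¹x₁, x₁⁻¹x₂, …` of consecutive elements of a list. -/
def quotients : G → List G → List G
  | _, [] => []
  | x, y :: l => x⁻¹ * y :: quotients y l

/-- The partial products `xg₁, xg₁g₂, …`. -/
def products : G → List G → List G
  | _, [] => []
  | x, g :: l => x * g :: products (x * g) l

@[simp] theorem length_quotients (x : G) (l : List G) : (quotients x l).length = l.length := by
  induction l generalizing x with
  | nil => rfl
  | cons y l ih => simp [quotients, ih]

@[simp] theorem length_products (x : G) (l : List G) : (products x l).length = l.length := by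
  induction l generalizing x with
  | nil => rfl
  | cons y l ih => simp [products, ih]

@[simp] theorem quotients_products (x : G) (l : List G) : quotients x (products x l) = l := by
  induction l generalizing x with
  | nil => rfl
  | cons y l ih => simp [quotients, products, ih]

@[simp] theorem products_quotients (x : G) (l : List G) : products x (quotients x l) = l := by
  induction l generalizing x with
  | nil => rfl
  | cons y l ih => simp [quotients, products, ih]

theorem quotients_map_mul (g x : G) (l : List G) :
    quotients (g * x) (l.map (g * ·)) = quotients x l := by
  induction l generalizing x with
  | nil => rfl
  | cons y l ih => simp [quotients, ih, mul_assoc]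

theorem products_mul (g x : G) (l : List G) :
    products (g * x) l = (products x l).map (g * ·) := by
  induction l generalizing x with
  | nil => rfl
  | cons y l ih => simp [products, ← ih, mul_assoc]

theorem products_ofFn (x : G) {m : ℕ} (y : Fin m → G) :
    products x (List.ofFn y) = List.ofFn fun j : Fin m => x * Fin.partialProd y j.succ := by
  induction m generalizing x with
  | zero => simp [products]
  | succ m ih =>
    rw [List.ofFn_succ, List.ofFn_succ, products, ih]
    simp only [Fin.partialProd_succ', ← mul_assoc]
    simp [Fin.tail_def]

/-- Deleting an inner vertex merges two consecutive quotients into their product, and deleting the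
last vertex drops the last quotient. The base point `x` is never deleted, so the first bar face is
absent. -/
theorem listD_quotients (F : List G → M) (x y : G) (l : List G) :
    listD (fun l => F (quotients x l)) (y :: l) = barSum F (quotients x (y :: l)) := by
  induction l generalizing F x y with
  | nil => simp [listD, quotients, barSum]
  | cons z l ih =>
    rw [listD]
    simp only [quotients, barSum]
    have := ih (fun l => F (x⁻¹ * y :: l)) y z
    simp only [quotients] at this
    rw [this]
    congr 2
    simp [mul_assoc]

theorem barSum_ofFn (m : ℕ) (f : List G → M) (x : Fin (m + 1) → G) :
    barSum f (List.ofFn x) =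
      ∑ j : Fin (m + 1), (-1 : ℤ) ^ (j : ℕ) • f (List.ofFn (Fin.contractNth j (· * ·) x)) := by
  induction m generalizing f with
  | zero => simp [barSum]
  | succ m ih =>
    have h := ih (fun l => f (x 0 :: l)) (fun i => x i.succ)
    rw [List.ofFn_succ] at h
    rw [List.ofFn_succ, List.ofFn_succ, barSum, Fin.sum_univ_succ, h, sub_eq_add_neg,
      ← Finset.sum_neg_distrib]
    congr 1
    · simp [List.ofFn_succ, Fin.contractNth]
    · refine Finset.sum_congr rfl fun j _ => ?_
      rw [Fin.val_succ, pow_succ, mul_neg_one, neg_smul, List.ofFn_succ]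
      congr 3
      congr 1
      congr 1
      funext i
      simp [Fin.contractNth]

/-- The value of a cochain at the list of its arguments. -/
def onList {m : ℕ} {S : Type*} (f : (Fin m → G) → S) (l : List G) : S :=
  -- The default `1` fills missing positions and never occurs at lists of length `m`.
  f fun i => l.getD i 1

theorem onList_ofFn {m : ℕ} {S : Type*} (f : (Fin m → G) → S) (x : Fin m → G) :
    onList f (List.ofFn x) = f x := by
  unfold onList
  congr 1
  funext i
  simp [List.getD]

end Bar

theorem List.exists_ofFn_eq {X : Type*} {m : ℕ} (l : List X) (hl : l.length = m) :
    ∃ x : Fin m → X, List.ofFn x = l := by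
  subst hl
  exact ⟨l.get, List.ofFn_get l⟩

/-! ### Calculus of the operators `[g]` on `A`. -/

namespace UnitalPartialAction

variable {K G A : Type*} [CommRing K] [Group G] [Ring A] [Algebra K A]
  (α : UnitalPartialAction K G A)

theorem e_mul_of_mem {g : G} {x : A} (hx : x ∈ α.D g) : α.e g * x = x := by
  obtain ⟨b, rfl⟩ := (α.mem_D_iff _ _).1 hx
  rw [← mul_assoc, α.e_idem]

theorem mem_D_of_e_mul {g : G} {x : A} (hx : α.e g * x = x) : x ∈ α.D g :=
  (α.mem_D_iff _ _).2 ⟨x, hx.symm⟩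

theorem e_mul_bracket (g : G) (a : A) : α.e g * α.bracket g a = α.bracket g a :=
  α.e_mul_of_mem (Subtype.property _)

theorem act_eq_bracket (g : G) (a : α.D g⁻¹) : (α.act g a : A) = α.bracket g a := by
  unfold bracket
  congr 2
  exact Subtype.ext (α.e_mul_of_mem a.2).symm

theorem bracket_add (g : G) (a b : A) : α.bracket g (a + b) = α.bracket g a + α.bracket g b := by
  unfold bracket
  rw [← Submodule.coe_add, ← map_add]
  congr 2
  exact Subtype.ext (mul_add _ _ _)

/-- `bracket` as an additive map. -/
def bracketHom (g : G) : A →+ A := AddMonoidHom.mk' (α.bracket g) (α.bracket_add g)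

@[simp] theorem bracketHom_apply (g : G) (a : A) : α.bracketHom g a = α.bracket g a := rfl

theorem bracket_zero (g : G) : α.bracket g 0 = 0 := map_zero (α.bracketHom g)

theorem bracket_mul (g : G) (a b : A) : α.bracket g (a * b) = α.bracket g a * α.bracket g b := by
  unfold bracket
  rw [← α.map_mul]
  congr 2
  refine Subtype.ext ?_
  change _ = α.e g⁻¹ * a * (α.e g⁻¹ * b)
  rw [mul_assoc, ← mul_assoc a, ← α.e_comm _ a, mul_assoc, ← mul_assoc (α.e g⁻¹) (α.e g⁻¹),
    α.e_idem]

theorem bracket_inv_bracket (g : G) (a : A) :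
    α.bracket g⁻¹ (α.bracket g a) = α.e g⁻¹ * a := by
  have := α.bracket_bracket_inv g⁻¹ a
  rwa [inv_inv] at this

theorem bracket_e_inv_mul (g : G) (a : A) : α.bracket g (α.e g⁻¹ * a) = α.bracket g a := by
  unfold bracket
  congr 2
  refine Subtype.ext ?_
  change α.e g⁻¹ * (α.e g⁻¹ * a) = _
  rw [← mul_assoc, α.e_idem]

theorem bracket_one (g : G) : α.bracket g 1 = α.e g := by
  have h : α.bracket g 1 * α.e g = α.e g := by
    rw [← mul_one (α.e g), ← α.bracket_bracket_inv, ← α.bracket_mul, one_mul]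
  rw [← h, ← α.e_comm, α.e_mul_bracket]

theorem e_one : α.e 1 = 1 := by
  have : (1 : A) ∈ α.D 1 := by rw [α.D_one]; trivial
  simpa using α.e_mul_of_mem this

theorem bracket_bracket_of_mem {g h : G} {a : A} (ha : α.e h⁻¹ * a = a)
    (hb : α.e g⁻¹ * α.bracket h a = α.bracket h a) :
    α.bracket g (α.bracket h a) = α.bracket (g * h) a := by
  have ha1 := α.mem_D_of_e_mul ha
  have hact := α.act_eq_bracket h ⟨a, ha1⟩
  have hb1 : (α.act h ⟨a, ha1⟩ : A) ∈ α.D g⁻¹ := hact ▸ α.mem_D_of_e_mul hb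
  obtain ⟨ha', h1⟩ := α.act_act g h ⟨a, ha1⟩ hb1
  rw [α.act_eq_bracket, α.act_eq_bracket] at h1
  simp only [hact] at h1
  exact h1.symm

/-- The element `b` is chosen so that `[h] b = 1_{g⁻¹} 1_h` lies where `α_g` is defined; then `[g]
1_h = [gh] b` lies in `D (g * h)`. -/
theorem e_mul_bracket_e (g h : G) :
    α.e (g * h) * α.bracket g (α.e h) = α.bracket g (α.e h) := by
  set b := α.bracket h⁻¹ (α.e g⁻¹ * α.e h)
  have hb : α.bracket h b = α.e g⁻¹ * α.e h := by
    rw [α.bracket_bracket_inv, α.e_comm g⁻¹, ← mul_assoc, α.e_idem]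
  have := α.bracket_bracket_of_mem (g := g) (h := h) (a := b) (α.e_mul_bracket _ _)
    (by rw [hb, ← mul_assoc, α.e_idem])
  rw [hb, α.bracket_e_inv_mul] at this
  rw [this, α.e_mul_bracket]

theorem bracket_e (g h : G) : α.bracket g (α.e h) = α.e g * α.e (g * h) := by
  have h1 : α.e h * α.bracket g⁻¹ (α.e (g * h)) = α.bracket g⁻¹ (α.e (g * h)) := by
    simpa using α.e_mul_bracket_e g⁻¹ (g * h)
  have h2 : α.bracket g (α.e h) * (α.e g * α.e (g * h)) = α.e g * α.e (g * h) := by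
    rw [← α.bracket_bracket_inv, ← α.bracket_mul, h1]
  rw [← h2, ← mul_assoc, ← α.e_comm g, α.e_mul_bracket, ← α.e_comm (g * h), α.e_mul_bracket_e]

/-- The axiom compares `α_g α_h` with `α_{gh}` only where the composite is defined, so `a` is first
cut down to its component `b` there. The idempotents this introduces are turned by `[gh]` into
`1_g`, up to the redundant `1_{gh}`. -/
theorem bracket_bracket (g h : G) (a : A) :
    α.bracket g (α.bracket h a) = α.e g * α.bracket (g * h) a := by
  set b := α.bracket h⁻¹ (α.e g⁻¹ * α.bracket h a) with hbdef
  have hb : α.bracket h b = α.e g⁻¹ * α.bracket h a := by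
    rw [α.bracket_bracket_inv, ← mul_assoc, ← α.e_comm, mul_assoc, α.e_mul_bracket]
  have h1 := α.bracket_bracket_of_mem (g := g) (h := h) (a := b) (α.e_mul_bracket _ _)
    (by rw [hb, ← mul_assoc, α.e_idem])
  rw [hb, α.bracket_e_inv_mul] at h1
  have h2 : b = α.e h⁻¹ * α.e (h⁻¹ * g⁻¹) * (α.e h⁻¹ * a) := by
    rw [hbdef, α.bracket_mul, α.bracket_inv_bracket, α.bracket_e]
  have h3 : h⁻¹ * g⁻¹ = (g * h)⁻¹ := by group
  have h4 : α.bracket (g * h) (α.e h⁻¹) = α.e (g * h) * α.e g := by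
    rw [α.bracket_e, mul_inv_cancel_right]
  rw [h1, h2, h3, α.e_comm h⁻¹, mul_assoc, α.bracket_e_inv_mul, ← mul_assoc, α.e_idem,
    α.bracket_mul, h4, α.e_comm (g * h), mul_assoc, α.e_mul_bracket]

end UnitalPartialAction

/-! ### Products of indecomposable algebras. -/

theorem IsIndecomposableRing.idempotent_apply {Λ : Type*} {A : Λ → Type*} [∀ l, Ring (A l)]
    (hA : ∀ l, IsIndecomposableRing (A l)) {c : ∀ l, A l} (h1 : c * c = c)
    (h2 : ∀ a, c * a = a * c) (l : Λ) : c l = 0 ∨ c l = 1 := by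
  classical
  refine (hA l).2 _ (congrFun h1 l) fun a => ?_
  simpa using congrFun (h2 (Pi.single l a)) l

namespace UnitalPartialAction

variable {K G Λ : Type*} {A : Λ → Type*} [CommRing K] [Group G]
    [∀ l, Ring (A l)] [∀ l, Algebra K (A l)]

theorem e_apply (hA : ∀ l, IsIndecomposableRing (A l)) (α : UnitalPartialAction K G (∀ l, A l))
    (g : G) (l : Λ) : α.e g l = 0 ∨ α.e g l = 1 :=
  IsIndecomposableRing.idempotent_apply hA (α.e_idem g) (α.e_comm g) l

/-- A partial action on a product of indecomposable algebras permutes the factors. -/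
theorem exists_bracket_apply_eq (hA : ∀ l, IsIndecomposableRing (A l))
    (α : UnitalPartialAction K G (∀ l, A l)) {g : G} {m : Λ} (hm : α.e g m = 1) :
    ∃ (l : Λ) (θ : A l →+ A m), ∀ a, α.bracket g a m = θ (a l) := by
  classical
  have hcentral : ∀ (h : G) (x : ∀ l, A l), (∀ a, x * a = a * x) →
      ∀ a, α.bracket h x * a = a * α.bracket h x := by
    intro h x hx a
    have h1 : α.bracket h x * (α.e h * a) = (α.e h * a) * α.bracket h x := by
      rw [← α.bracket_bracket_inv, ← α.bracket_mul, ← α.bracket_mul, hx]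
    rw [← mul_assoc, ← α.e_comm, α.e_mul_bracket] at h1
    rw [h1, α.e_comm, mul_assoc, α.e_mul_bracket]
  have hidem : ∀ (h : G) (x : ∀ l, A l), x * x = x →
      α.bracket h x * α.bracket h x = α.bracket h x := by
    intro h x hx
    rw [← α.bracket_mul, hx]
  have hsc : ∀ (l : Λ) (a : ∀ l, A l), Pi.single l (1 : A l) * a = a * Pi.single l 1 := by
    intro l a
    funext k
    by_cases hk : k = l
    · subst hk; simp
    · simp [hk]
  have hsi : ∀ (l : Λ), Pi.single l (1 : A l) * Pi.single l 1 = Pi.single l (1 : A l) := by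
    intro l
    rw [← Pi.single_mul, one_mul]
  have hm1 : α.e g * Pi.single m 1 = Pi.single m 1 := by
    funext k
    by_cases hk : k = m
    · subst hk; simp [hm]
    · simp [hk]
  have := fun l => (hA l).1
  -- The nonzero central idempotent `c` must be `1` at some factor `l`. The image `d` of the unit of
  -- the factor `l` then lies below the unit of the factor `m` and is nonzero, so it equals that
  -- unit. Multiplying `a` by the unit of `l` thus does not change `[g] a` at `m`.
  set c := α.bracket g⁻¹ (Pi.single m 1) with hc
  have hgc : α.bracket g c = Pi.single m 1 := by rw [hc, α.bracket_bracket_inv, hm1]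
  have hc0 : c ≠ 0 := by
    intro h
    rw [h, α.bracket_zero] at hgc
    have := congrFun hgc m
    simp at this
  obtain ⟨l, hl⟩ : ∃ l, c l ≠ 0 := by
    by_contra! h
    exact hc0 (funext h)
  have hl1 : c l = 1 := (IsIndecomposableRing.idempotent_apply hA (hidem _ _ (hsi m))
    (hcentral _ _ (hsc m)) l).resolve_left hl
  have hlc : Pi.single l 1 * c = Pi.single l 1 := by
    funext k
    by_cases hk : k = l
    · subst hk; simp [hl1]
    · simp [hk]
  set d := α.bracket g (Pi.single l 1) with hd
  have hdm : d * Pi.single m 1 = d := by rw [← hgc, hd, ← α.bracket_mul, hlc]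
  have hdinv : α.bracket g⁻¹ d = Pi.single l 1 := by
    rw [hd, α.bracket_inv_bracket, ← hlc, hc, ← mul_assoc, α.e_comm, mul_assoc, α.e_mul_bracket]
  have hd1 : d m = 1 := by
    refine (IsIndecomposableRing.idempotent_apply hA (hidem _ _ (hsi l))
      (hcentral _ _ (hsc l)) m).resolve_left fun h0 => ?_
    have : d = 0 := by
      rw [← hdm]
      funext k
      by_cases hk : k = m
      · subst hk; simpa using h0
      · simp [hk]
    rw [this, α.bracket_zero] at hdinv
    have := congrFun hdinv l
    simp at this
  refine ⟨l, (Pi.evalAddMonoidHom A m).comp ((α.bracketHom g).comp (AddMonoidHom.single A l)),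
    fun a => ?_⟩
  have h1 : Pi.single l (a l) = a * Pi.single l 1 := by
    funext k
    by_cases hk : k = l
    · subst hk; simp
    · simp [hk]
  simp only [AddMonoidHom.comp_apply, AddMonoidHom.single_apply, bracketHom_apply,
    Pi.evalAddMonoidHom_apply, h1, α.bracket_mul, Pi.mul_apply, ← hd, hd1, mul_one]

end UnitalPartialAction

/-! ### The enveloping algebra, its local units and its multipliers. -/

namespace GlobalAction

variable {K G B : Type*} [CommRing K] [Group G] [NonUnitalRing B] [Module K B]
  (β : GlobalAction K G B)

theorem act_mul_apply (g h : G) (b : B) :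
    β.act (g * h) b = β.act g (β.act h b) := by
  rw [_root_.map_mul]; rfl

theorem act_act_inv (g : G) (b : B) :
    β.act g (β.act g⁻¹ b) = b := by
  rw [← β.act_mul_apply, mul_inv_cancel, _root_.map_one]; rfl

theorem act_symm_apply (g : G) (b : B) :
    (β.act g).symm b = β.act g⁻¹ b := by
  rw [LinearEquiv.symm_apply_eq, β.act_act_inv]

theorem multiplierRep_apply [IsScalarTower K B B] [SMulCommClass K B B] (g : G)
    (u : Multiplier K B) (b : B) :
    (β.multiplierRep g u).1.1 b = β.act g (u.1.1 (β.act g⁻¹ b)) := by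
  rw [← β.act_symm_apply]; rfl

end GlobalAction

namespace IsEnvelopingAction

variable {K G A B : Type*} [CommRing K] [Group G] [Ring A] [Algebra K A]
  [NonUnitalRing B] [Module K B] [IsScalarTower K B B] [SMulCommClass K B B]
  {α : UnitalPartialAction K G A} {β : GlobalAction K G B} {φ : A →ₙₐ[K] B}
  (hφ : IsEnvelopingAction α.toPartialAction β φ)

include hφ

theorem map_bracket (g : G) (a : A) : φ (α.bracket g a) = β.act g (φ (α.e g⁻¹ * a)) :=
  hφ.map_act g _

theorem map_e (g : G) : φ (α.e g) = β.act g (φ (α.e g⁻¹)) := by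
  rw [← α.bracket_one, hφ.map_bracket, mul_one]

/-- The product lies in `φ(A) ∩ β_g(φ(A)) = φ(D_g)`, and multiplying it on the left by `φ(1_g)`
gives both itself and `φ(1_g)`. -/
theorem map_one_mul_act_map_one (g : G) : φ 1 * β.act g (φ 1) = φ (α.e g) := by
  have h1 : φ (α.e g) * β.act g (φ 1) = φ (α.e g) := by
    rw [hφ.map_e, ← β.map_mul, ← map_mul, mul_one]
  have h2 : φ 1 * β.act g (φ 1) ∈ φ '' (α.D g : Set A) := by
    rw [hφ.image_D]
    refine ⟨hφ.mul_mem_right _ _, ?_⟩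
    obtain ⟨c, hc⟩ := hφ.mul_mem_left (β.act g⁻¹ (φ 1)) 1
    exact ⟨φ c, ⟨c, rfl⟩, by rw [hc, β.map_mul, β.act_act_inv]⟩
  obtain ⟨d, hd, hd'⟩ := h2
  rw [← hd', ← α.e_mul_of_mem hd, map_mul, hd', ← mul_assoc, ← map_mul, mul_one, h1]

theorem map_mul_act_map_one (g : G) (a : A) : φ a * β.act g (φ 1) = φ (a * α.e g) := by
  rw [map_mul, ← hφ.map_one_mul_act_map_one, ← mul_assoc, ← map_mul, mul_one]

theorem map_one_mul_act_map (g : G) (a : A) : φ 1 * β.act g (φ a) = φ (α.bracket g a) := by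
  rw [hφ.map_bracket, map_mul, β.map_mul, ← hφ.map_e, ← hφ.map_one_mul_act_map_one, mul_assoc,
    ← β.map_mul, ← map_mul, one_mul]

/-- Each translate of `φ(A)` is an ideal, so the linear span is already closed under multiplication.
-/
theorem span_eq_top : Submodule.span K (⋃ g : G, β.act g '' Set.range φ) = ⊤ := by
  have hmul : ∀ x y, x ∈ Submodule.span K (⋃ g : G, β.act g '' Set.range φ) →
      x * y ∈ Submodule.span K (⋃ g : G, β.act g '' Set.range φ) := by
    intro x y hx
    induction hx using Submodule.span_induction with
    | mem x hx =>
      obtain ⟨g, _, ⟨a, rfl⟩, rfl⟩ := Set.mem_iUnion.1 hx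
      obtain ⟨c, hc⟩ := hφ.mul_mem_right a (β.act g⁻¹ y)
      refine Submodule.subset_span (Set.mem_iUnion.2 ⟨g, φ c, ⟨c, rfl⟩, ?_⟩)
      rw [hc, β.map_mul, β.act_act_inv]
    | zero => simp
    | add x z _ _ h1 h2 => rw [add_mul]; exact add_mem h1 h2
    | smul k x _ h => rw [smul_mul_assoc]; exact Submodule.smul_mem _ _ h
  rw [eq_top_iff]
  intro b _
  have hb : b ∈ NonUnitalAlgebra.adjoin K (⋃ g : G, β.act g '' Set.range φ) := by
    rw [hφ.generates]; trivial
  induction hb using NonUnitalAlgebra.adjoin_induction with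
  | mem x hx => exact Submodule.subset_span hx
  | zero => simp
  | add x y _ _ h1 h2 => exact add_mem (h1 trivial) (h2 trivial)
  | smul k x _ h => exact Submodule.smul_mem _ _ (h trivial)
  | mul x y _ _ h1 _ => exact hmul x y (h1 trivial)

theorem induction_on {p : B → Prop} (b : B) (hp : ∀ g a, p (β.act g (φ a)))
    (h0 : p 0) (hadd : ∀ x y, p x → p y → p (x + y)) : p b := by
  have hb : b ∈ Submodule.span K (⋃ g : G, β.act g '' Set.range φ) := by
    rw [hφ.span_eq_top]; trivial
  have : ∀ k : K, p (k • b) := by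
    induction hb using Submodule.span_induction with
    | mem x hx =>
      obtain ⟨g, _, ⟨a, rfl⟩, rfl⟩ := Set.mem_iUnion.1 hx
      intro k
      rw [← map_smul, ← map_smul]
      exact hp _ _
    | zero => simpa
    | add x z _ _ h1 h2 => intro k; rw [smul_add]; exact hadd _ _ (h1 k) (h2 k)
    | smul k x _ h => intro k'; rw [smul_smul]; exact h _
  simpa using this 1

theorem unit_comm (g : G) (b : B) : β.act g (φ 1) * b = b * β.act g (φ 1) := by
  obtain ⟨c, hc⟩ := hφ.mul_mem_right 1 (β.act g⁻¹ b)
  obtain ⟨d, hd⟩ := hφ.mul_mem_left (β.act g⁻¹ b) 1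
  have h1 : φ 1 * β.act g⁻¹ b = β.act g⁻¹ b * φ 1 := by
    have e1 : φ 1 * β.act g⁻¹ b * φ 1 = φ 1 * β.act g⁻¹ b := by
      rw [← hc, ← map_mul, mul_one]
    have e2 : φ 1 * (β.act g⁻¹ b * φ 1) = β.act g⁻¹ b * φ 1 := by
      rw [← hd, ← map_mul, one_mul]
    rw [← e1, mul_assoc, e2]
  have := congrArg (β.act g) h1
  rwa [β.map_mul, β.map_mul, β.act_act_inv] at this

/-- The local units `β_g(φ(1))` separate the elements of `B`. -/
theorem eq_zero_of_unit_mul {b : B} (hb : ∀ g, β.act g (φ 1) * b = 0) : b = 0 := by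
  have hmul : ∀ x : B, x * b = 0 := fun x => by
    refine hφ.induction_on (p := fun x => x * b = 0) x (fun g a => ?_) (zero_mul b)
      fun x y hx hy => by rw [add_mul, hx, hy, add_zero]
    rw [← mul_one a, map_mul, β.map_mul, mul_assoc, hb, mul_zero]
  -- Every `b` has a central left unit: it is a finite sum of elements of translates, and central
  -- units `e`, `f` of two summands combine to `e + f - e * f`.
  obtain ⟨e, -, he⟩ : ∃ e : B, (∀ x, e * x = x * e) ∧ e * b = b := by
    refine hφ.induction_on (p := fun b => ∃ e : B, (∀ x, e * x = x * e) ∧ e * b = b) b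
      (fun g a => ⟨β.act g (φ 1), hφ.unit_comm g, ?_⟩) ⟨0, by simp⟩ ?_
    · rw [← β.map_mul, ← map_mul, one_mul]
    · rintro x y ⟨e, he, hex⟩ ⟨f, hf, hfy⟩
      refine ⟨e + f - e * f, fun z => ?_, ?_⟩
      · rw [sub_mul, add_mul, mul_sub, mul_add, he, hf, mul_assoc, hf, ← mul_assoc, he, mul_assoc]
      · have h1 : e * f * x = f * x := by rw [he, mul_assoc, hex]
        have h2 : e * f * y = e * y := by rw [mul_assoc, hfy]
        rw [sub_mul, add_mul, mul_add, mul_add, mul_add, h1, h2, hex, hfy]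
        abel
  rw [← he, hmul]

theorem eq_of_unit_mul {b c : B} (h : ∀ g, β.act g⁻¹ (φ 1) * b = β.act g⁻¹ (φ 1) * c) :
    b = c := by
  rw [← sub_eq_zero]
  refine hφ.eq_zero_of_unit_mul fun g => ?_
  have := h g⁻¹
  rw [inv_inv] at this
  rw [mul_sub, this, sub_self]

theorem exists_map_eq_multiplier (u : Multiplier K B) : ∃ a, φ a = u.1.1 (φ 1) := by
  have h : u.1.1 (φ 1) = φ 1 * u.1.1 (φ 1) := by
    rw [← u.2.1, ← map_mul, one_mul]
  rw [h]
  exact hφ.mul_mem_right _ _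

/-- The restriction of a multiplier of `B` to `A`, as an element of `A`. -/
noncomputable def restrict : Multiplier K B →+ A :=
  AddMonoidHom.mk' (fun u => (hφ.exists_map_eq_multiplier u).choose) fun u v => hφ.injective (by
    rw [map_add, (hφ.exists_map_eq_multiplier _).choose_spec,
      (hφ.exists_map_eq_multiplier _).choose_spec, (hφ.exists_map_eq_multiplier _).choose_spec]
    rfl)

theorem map_restrict (u : Multiplier K B) : φ (hφ.restrict u) = u.1.1 (φ 1) :=
  (hφ.exists_map_eq_multiplier u).choose_spec

theorem multiplier_map (u : Multiplier K B) (a : A) : u.1.1 (φ a) = φ (a * hφ.restrict u) := by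
  rw [map_mul, hφ.map_restrict, ← u.2.1, ← map_mul, mul_one]

theorem bracket_restrict (g : G) (u : Multiplier K B) :
    α.bracket g (hφ.restrict u) = α.e g * hφ.restrict (β.multiplierRep g u) := by
  apply hφ.injective
  rw [hφ.map_bracket, ← hφ.multiplier_map, ← hφ.multiplier_map, β.multiplierRep_apply, hφ.map_e,
    inv_inv]

/-- The hypothesis makes the right component vanish on all translates of `φ(A)`. The left component
follows from `(aR)b = a(Lb)` with `a` running over the local units. -/
theorem multiplier_eq_zero {u : Multiplier K B}
    (h : ∀ g, hφ.restrict (β.multiplierRep g u) = 0) : u = 0 := by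
  have hR : ∀ b, u.1.1 b = 0 := fun b => by
    refine hφ.induction_on (p := fun b => u.1.1 b = 0) b (fun g a => ?_) (map_zero _) fun x y hx hy => by
      rw [map_add, hx, hy, add_zero]
    have h1 := hφ.multiplier_map (β.multiplierRep g⁻¹ u) a
    rw [h, mul_zero, map_zero, β.multiplierRep_apply, inv_inv] at h1
    exact (LinearEquiv.map_eq_zero_iff _).1 h1
  refine Subtype.ext (Prod.ext (LinearMap.ext hR) (LinearMap.ext fun b => ?_))
  refine hφ.eq_zero_of_unit_mul fun g => ?_
  rw [← u.2.2.2, hR, zero_mul]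

theorem multiplier_ext {u v : Multiplier K B}
    (h : ∀ g, hφ.restrict (β.multiplierRep g u) = hφ.restrict (β.multiplierRep g v)) :
    u = v := by
  rw [← sub_eq_zero]
  exact hφ.multiplier_eq_zero fun g => by rw [map_sub, map_sub, h, sub_self]

/-- A compatible family of elements of `A` is the family of the restrictions of the translates of
a multiplier of `B`. -/
theorem exists_multiplier (a : G → A) (ha : ∀ g k, α.bracket g (a k) = α.e g * a (g * k)) :
    ∃ v : Multiplier K B, ∀ g, hφ.restrict (β.multiplierRep g v) = a g := by
  -- `E k` is the unit of the translate of `φ(A)` by `k⁻¹`, and `P k` is the value that the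
  -- multiplier must take there. Compatibility of `a` amounts to `hPE`.
  set E : G → B := fun k => β.act k⁻¹ (φ 1) with hE
  set P : G → B := fun k => β.act k⁻¹ (φ (a k)) with hP
  have hEc : ∀ k b, E k * b = b * E k := fun k b => hφ.unit_comm _ b
  have hEP : ∀ k, E k * P k = P k := fun k => by
    simp only [hE, hP]
    rw [← β.map_mul, ← map_mul, one_mul]
  have hEE : ∀ k, E k * E k = E k := fun k => by
    simp only [hE]
    rw [← β.map_mul, ← map_mul, one_mul]
  have hPE : ∀ h k, P h * E k = E h * P k := fun h k => by
    have h1 : φ (a h) * β.act (h * k⁻¹) (φ 1) = φ 1 * β.act (h * k⁻¹) (φ (a k)) := by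
      rw [hφ.map_mul_act_map_one, hφ.map_one_mul_act_map, ha, inv_mul_cancel_right, α.e_comm]
    have h2 := congrArg (β.act h⁻¹) h1
    rwa [β.map_mul, β.map_mul, ← β.act_mul_apply, ← β.act_mul_apply, inv_mul_cancel_left] at h2
  have hu : ∀ {b c : B}, (∀ k, E k * b = E k * c) → b = c := fun h => hφ.eq_of_unit_mul h
  have hEx : ∀ g x, E g⁻¹ * β.act g (φ x) = β.act g (φ x) := fun g x => by
    simp only [hE]
    rw [inv_inv, ← β.map_mul, ← map_mul, one_mul]
  -- The value at `b` is prescribed through all its products with local units. Since these separate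
  -- elements (`hu`), linearity and the multiplier identities can be checked after multiplication by
  -- each `E k`.
  have hR : ∀ b, ∃ c, ∀ k, E k * c = b * P k := fun b => by
    refine hφ.induction_on (p := fun b => ∃ c, ∀ k, E k * c = b * P k) b (fun g x => ?_)
      ⟨0, by simp⟩ ?_
    · refine ⟨β.act g (φ x) * P g⁻¹, fun k => ?_⟩
      rw [hEc, mul_assoc, hPE, ← mul_assoc, ← hEc, hEx]
    · rintro x y ⟨c, hc⟩ ⟨d, hd⟩
      exact ⟨c + d, fun k => by rw [mul_add, hc, hd, add_mul]⟩
  have hL : ∀ b, ∃ c, ∀ k, E k * c = P k * b := fun b => by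
    refine hφ.induction_on (p := fun b => ∃ c, ∀ k, E k * c = P k * b) b (fun g x => ?_)
      ⟨0, by simp⟩ ?_
    · refine ⟨P g⁻¹ * β.act g (φ x), fun k => ?_⟩
      rw [← mul_assoc, ← hPE, mul_assoc, hEx]
    · rintro x y ⟨c, hc⟩ ⟨d, hd⟩
      exact ⟨c + d, fun k => by rw [mul_add, hc, hd, mul_add]⟩
  choose R hR using hR
  choose L hL using hL
  refine ⟨⟨⟨{ toFun := R, map_add' := fun x y => hu fun k => ?_,
              map_smul' := fun c x => hu fun k => ?_ },
            { toFun := L, map_add' := fun x y => hu fun k => ?_,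
              map_smul' := fun c x => hu fun k => ?_ }⟩,
          fun x y => hu fun k => ?_, fun x y => hu fun k => ?_, fun x y => hu fun k => ?_⟩,
        fun g => hφ.injective ?_⟩
  · rw [mul_add, hR, hR, hR, add_mul]
  · rw [RingHom.id_apply, mul_smul_comm, hR, hR, smul_mul_assoc]
  · rw [mul_add, hL, hL, hL, mul_add]
  · rw [RingHom.id_apply, mul_smul_comm, hL, hL, mul_smul_comm]
  · change E k * R (x * y) = E k * (x * R y)
    rw [hR, ← mul_assoc, hEc, mul_assoc x (E k), hR, mul_assoc]
  · change E k * L (x * y) = E k * (L x * y)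
    rw [hL, ← mul_assoc, ← mul_assoc, hL]
  · change E k * (R x * y) = E k * (x * L y)
    rw [← mul_assoc, hR, ← mul_assoc, hEc, mul_assoc x (E k), hL, mul_assoc]
  · rw [hφ.map_restrict, β.multiplierRep_apply]
    change β.act g (R (E g)) = φ (a g)
    have h1 : R (E g) = P g := by
      have h2 : R (E g) = E g * R (E g) := hu fun k => by
        rw [hR, ← mul_assoc, hEc k, mul_assoc, hR, ← mul_assoc, hEE]
      rw [h2, hR, hEP]
    rw [h1, β.act_act_inv]

end IsEnvelopingAction

/-! ### Homogeneous cochains and equivariant retractions. -/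

section Homogeneous

variable {G M N : Type*} [Group G] [AddCommGroup M] [AddCommGroup N]

/-- The homogeneous cochain `(x, x₁, …) ↦ F x (f(x⁻¹x₁, x₁⁻¹x₂, …))` of an inhomogeneous one. -/
def homogeneous (F : G → M →+ N) (f : List G → M) : List G → N
  | [] => 0
  | x :: l => F x (f (quotients x l))

theorem listD_homogeneous (F : G → M →+ N) (f : List G → M) (x y : G) (l : List G) :
    listD (homogeneous F f) (x :: y :: l) =
      F y (f (quotients y l)) - F x (barSum f (quotients x (y :: l))) := by
  rw [listD, ← listD_quotients, map_listD]
  rfl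

/-- A choice of an element of `T`, equivariant in the pair `(T, x)`. -/
noncomputable def retraction (T : Set G) (x : G) : G :=
  x * Classical.epsilon fun m => x * m ∈ T

theorem retraction_mem {T : Set G} (hT : T.Nonempty) (x : G) : retraction T x ∈ T := by
  obtain ⟨t, ht⟩ := hT
  exact Classical.epsilon_spec (p := fun m => x * m ∈ T) ⟨x⁻¹ * t, by simpa using ht⟩

/-- The choice is made in `x⁻¹T`, a set that does not change when `x` and `T` are both translated by
`g`. -/
theorem retraction_mul {T T' : Set G} {g : G} (h : ∀ y, g * y ∈ T' ↔ y ∈ T) (x : G) :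
    retraction T' (g * x) = g * retraction T x := by
  simp only [retraction, mul_assoc, h]

end Homogeneous

/-- Deleting the base point moves it from `x` to `y = x * z 0`; this accounts for the factor `ρ (z
0)` in the first face of the inhomogeneous coboundary. -/
theorem Representation.listD_homogeneous_delta {K G M N : Type*} [CommRing K] [Group G]
    [AddCommGroup M] [Module K M] [AddCommGroup N] (ρ : Representation K G M) (r : M →+ N) {m : ℕ}
    (f : List G → M) (x y : G) (l : List G) (z : Fin (m + 1) → G)
    (hz : List.ofFn z = quotients x (y :: l)) :
    listD (homogeneous (fun x => r.comp (ρ x).toAddMonoidHom) f) (x :: y :: l) =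
      r (ρ x (ρ.delta m (fun c => f (List.ofFn c)) z)) := by
  have hz' := hz
  rw [List.ofFn_succ, quotients, List.cons.injEq] at hz'
  have h0 : ρ y = ρ x * ρ (z 0) := by rw [← map_mul, hz'.1, mul_inv_cancel_left]
  have h1 : ρ.delta m (fun c => f (List.ofFn c)) z =
      ρ (z 0) (f (quotients y l)) - barSum f (quotients x (y :: l)) := by
    rw [← hz, barSum_ofFn, Representation.delta, hz'.2, sub_eq_add_neg, ← Finset.sum_neg_distrib]
    simp only [pow_succ, mul_neg_one, neg_smul]
  rw [listD_homogeneous, h1, map_sub, map_sub]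
  simp only [AddMonoidHom.comp_apply, h0]
  rfl

/-! ### Extending a primitive from the supports to all of `G`. -/

namespace UnitalPartialAction

section

variable {K G A : Type*} [CommRing K] [Group G] [Ring A] [Algebra K A]
  (α : UnitalPartialAction K G A)

theorem bracket_homogeneous {M : Type*} [AddCommGroup M] {F : G → M →+ A}
    (hF : ∀ g x m, α.bracket g (F x m) = α.e g * F (g * x) m) (f : List G → M) (g : G)
    (l : List G) :
    α.bracket g (homogeneous F f l) = α.e g * homogeneous F f (l.map (g * ·)) := by
  cases l with
  | nil => simp [homogeneous, α.bracket_zero]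
  | cons x l => simp only [homogeneous, List.map_cons, hF, quotients_map_mul]

theorem bracket_homogeneous_bracket (f : List G → A) (g : G) (l : List G) :
    α.bracket g (homogeneous α.bracketHom f l) =
      α.e g * homogeneous α.bracketHom f (l.map (g * ·)) :=
  α.bracket_homogeneous α.bracket_bracket f g l

end

variable {K G Λ : Type*} {A : Λ → Type*} [CommRing K] [Group G]
    [∀ l, Ring (A l)] [∀ l, Algebra K (A l)] (α : UnitalPartialAction K G (∀ l, A l))

/-- The set of the `y` such that the partial action of `y⁻¹` is defined at the factor `k`. -/
def supp (k : Λ) : Set G := {y | α.e y k = 1}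

theorem one_mem_supp (k : Λ) : (1 : G) ∈ α.supp k := by
  simp [supp, α.e_one]

theorem bracket_e_mul_apply {k : Λ} {x h : G} (hx : x ∈ α.supp k) (hxh : x * h ∈ α.supp k)
    (a : ∀ l, A l) : α.bracket x (α.e h * a) k = α.bracket x a k := by
  rw [α.bracket_mul, α.bracket_e, Pi.mul_apply, Pi.mul_apply, show α.e x k = 1 from hx,
    show α.e (x * h) k = 1 from hxh, one_mul, one_mul]

theorem bracket_eTuple_mul_apply {k : Λ} {x : G} (hx : x ∈ α.supp k) {m : ℕ} (z : Fin m → G)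
    (hz : ∀ y ∈ products x (List.ofFn z), y ∈ α.supp k) (a : ∀ l, A l) :
    α.bracket x (α.eTuple z * a) k = α.bracket x a k := by
  have key : ∀ L : List (∀ l, A l), (∀ b ∈ L, ∀ a, α.bracket x (b * a) k = α.bracket x a k) →
      ∀ a, α.bracket x (L.prod * a) k = α.bracket x a k := by
    intro L
    induction L with
    | nil => simp
    | cons b L ih =>
      intro h a
      rw [List.prod_cons, mul_assoc, h b (by simp),
        ih (fun c hc => h c (List.mem_cons_of_mem _ hc))]
  refine key _ (fun b hb a => ?_) a
  obtain ⟨j, rfl⟩ := List.mem_ofFn.1 hb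
  refine α.bracket_e_mul_apply hx (hz _ ?_) a
  rw [products_ofFn]
  exact List.mem_ofFn.2 ⟨j, rfl⟩

/-- When all vertices lie in `supp k`, the idempotents in the partial coboundary become `1` at the
factor `k` after `[x]` is applied, so the classical computation goes through. -/
theorem listD_homogeneous_delta_apply {k : Λ} {m : ℕ} (f : List G → ∀ l, A l) (x y : G)
    (l : List G) (z : Fin (m + 1) → G) (hz : List.ofFn z = quotients x (y :: l))
    (hl : ∀ t ∈ x :: y :: l, t ∈ α.supp k) :
    listD (fun l => homogeneous α.bracketHom f l k) (x :: y :: l) =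
      α.bracket x (α.delta m (fun c => f (List.ofFn c)) z) k := by
  have hz' := hz
  rw [List.ofFn_succ, quotients, List.cons.injEq] at hz'
  have hx : x ∈ α.supp k := hl x (by simp)
  have hprod : products x (List.ofFn z) = y :: l := by rw [hz, products_quotients]
  set θ := (Pi.evalAddMonoidHom A k).comp (α.bracketHom x) with hθ
  have hθe : ∀ a, α.bracket x a k = θ a := fun a => rfl
  have h2 : ∀ (j : Fin (m + 1)) (a : ∀ l, A l),
      θ (α.e (Fin.partialProd z j.succ) * a) = θ a := by
    intro j a
    refine α.bracket_e_mul_apply hx (hl _ (List.mem_cons_of_mem _ ?_)) a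
    rw [← hprod, products_ofFn]
    exact List.mem_ofFn.2 ⟨j, rfl⟩
  have h3 : θ (α.bracket (z 0) (f (quotients y l))) = α.bracket y (f (quotients y l)) k := by
    rw [← hθe, α.bracket_bracket, hz'.1, mul_inv_cancel_left, Pi.mul_apply,
      show α.e x k = 1 from hx, one_mul]
  have h4 := map_listD (Pi.evalAddMonoidHom A k) (homogeneous α.bracketHom f) (x :: y :: l)
  refine h4.symm.trans ?_
  rw [listD_homogeneous, hθe, delta, hz'.2, map_add, h3, map_sub, sub_eq_add_neg, map_sum, ← hz,
    barSum_ofFn]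
  refine congrArg₂ (· + ·) rfl ?_
  rw [← AddMonoidHom.comp_apply, ← hθ, map_sum, ← Finset.sum_neg_distrib]
  refine Finset.sum_congr rfl fun j _ => ?_
  rw [map_zsmul, map_zsmul, h2, pow_succ, mul_neg_one, neg_smul]

/-- The cochain obtained from `X` and `f` by means of the retractions onto the sets `supp k` and the
prism operators belonging to them. -/
noncomputable def transfer (X f : List G → ∀ l, A l) (l : List G) (k : Λ) : A k :=
  X (l.map (retraction (α.supp k))) k -
    listPrism (retraction (α.supp k)) (fun l => f l k) l

theorem bracket_transfer (hA : ∀ l, IsIndecomposableRing (A l)) {X f : List G → ∀ l, A l}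
    (hX : ∀ g l, α.bracket g (X l) = α.e g * X (l.map (g * ·)))
    (hf : ∀ g l, α.bracket g (f l) = α.e g * f (l.map (g * ·))) (g : G) (l : List G) :
    α.bracket g (α.transfer X f l) = α.e g * α.transfer X f (l.map (g * ·)) := by
  funext m
  rcases e_apply hA α g m with h0 | h1
  · rw [← α.e_mul_bracket, Pi.mul_apply, Pi.mul_apply, h0, zero_mul, zero_mul]
  obtain ⟨k, θ, hθ⟩ := exists_bracket_apply_eq hA α h1
  -- Since `θ 1 = 1`, the value `0` or `1` of `1_y` at `k` is carried by `θ` to the value of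
  -- `1_{gy}` at `m`.
  have hsupp : ∀ y, g * y ∈ α.supp m ↔ y ∈ α.supp k := by
    intro y
    have hy := hθ (α.e y)
    rw [α.bracket_e, Pi.mul_apply, h1, one_mul] at hy
    have hone := hθ 1
    rw [α.bracket_one, h1, Pi.one_apply] at hone
    have := (hA m).1
    rcases e_apply hA α y k with hk | hk
    · rw [hk, map_zero] at hy
      have := (hA k).1
      simp [supp, hy, hk]
    · rw [hk, ← hone] at hy
      simp [supp, hy, hk]
  have heq : ∀ {c : List G → ∀ l, A l},
      (∀ g l, α.bracket g (c l) = α.e g * c (l.map (g * ·))) →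
      ∀ l, θ (c l k) = c (l.map (g * ·)) m := by
    intro c hc l
    rw [← hθ, hc, Pi.mul_apply, h1, one_mul]
  rw [hθ, Pi.mul_apply, h1, one_mul]
  simp only [transfer]
  rw [map_sub, heq hX, map_listPrism,
    listPrism_map _ _ (g * ·) (retraction_mul hsupp)]
  simp only [heq hf, List.map_map]
  congr 3
  exact funext fun x => (retraction_mul hsupp x).symm

theorem listD_transfer_apply {X f : List G → ∀ l, A l} {m : ℕ} (k : Λ)
    (hf : ∀ l, l.length = m + 1 → listD f l = 0)
    (hX : ∀ l : List G, l.length = m → (∀ t ∈ l, t ∈ α.supp k) →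
      f l k = listD (fun l => X l k) l)
    (l : List G) (hl : l.length = m) : listD (α.transfer X f) l k = f l k := by
  set ρ := retraction (α.supp k)
  have hdf : ∀ l, l.length = m + 1 → listD (fun l => f l k) l = 0 := fun l' hl' => by
    have h2 := map_listD (Pi.evalAddMonoidHom A k) f l'
    rw [hf l' hl'] at h2
    exact h2.symm
  have h1 := listPrism_listD_add ρ (fun l => f l k) l
  -- As `f` is a cocycle, the homotopy formula reduces to `d(Pf) = f ∘ ρ - f`; `hX` applies to
  -- `l.map ρ` because its entries lie in `supp k`.
  rw [listPrism_eq_zero ρ m _ hdf l hl, zero_add,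
    hX (l.map ρ) (by simpa using hl) ?_, listD_map] at h1
  · have h2 := map_listD (Pi.evalAddMonoidHom A k) (α.transfer X f) l
    refine h2.trans ?_
    simp only [Pi.evalAddMonoidHom_apply, transfer]
    rw [listD_sub (fun l => X (l.map ρ) k), h1, sub_sub_cancel]
  · intro t ht
    obtain ⟨s, -, rfl⟩ := List.mem_map.1 ht
    exact retraction_mem ⟨1, α.one_mem_supp k⟩ s

end UnitalPartialAction

/-! ### Multiplier-valued cocycles whose restriction is a partial coboundary. -/

namespace IsEnvelopingAction

variable {K G Λ B : Type*} {A : Λ → Type*} [CommRing K] [Group G]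
    [∀ l, Ring (A l)] [∀ l, Algebra K (A l)]
    [NonUnitalRing B] [Module K B] [IsScalarTower K B B] [SMulCommClass K B B]
    {α : UnitalPartialAction K G (∀ l, A l)} {β : GlobalAction K G B}
    {φ : (∀ l, A l) →ₙₐ[K] B}

/-- A classical cocycle with values in the multipliers of `B` is a coboundary if its restriction to
`A` is a partial coboundary. -/
theorem exists_delta_eq (hφ : IsEnvelopingAction α.toPartialAction β φ)
    (hA : ∀ l, IsIndecomposableRing (A l)) {n : ℕ} (u : (Fin (n + 1) → G) → Multiplier K B)
    (hu : β.multiplierRep.IsCocycle u) (ξ : (Fin n → G) → ∀ l, A l)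
    (hξ : ∀ z, α.eTuple z * hφ.restrict (u z) = α.delta n ξ z) :
    ∃ v, u = β.multiplierRep.delta n v := by
  -- `F x` translates a multiplier by `x` and restricts it to `A`; the maps `F x` jointly determine
  -- the multiplier.
  set F : G → Multiplier K B →+ ∀ l, A l :=
    fun x => hφ.restrict.comp (β.multiplierRep x).toAddMonoidHom
  have hF : ∀ g x m, α.bracket g (F x m) = α.e g * F (g * x) m := by
    intro g x m
    have : β.multiplierRep (g * x) m = β.multiplierRep g (β.multiplierRep x m) := by
      rw [map_mul]; rfl
    exact (hφ.bracket_restrict g _).trans (congrArg (fun b => α.e g * hφ.restrict b) this.symm)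
  set f := homogeneous F (onList u) with hf
  set X := homogeneous α.bracketHom (onList ξ) with hX
  have hu' : (fun c : Fin (n + 1) → G => onList u (List.ofFn c)) = u := funext (onList_ofFn u)
  have hξ' : (fun c : Fin n → G => onList ξ (List.ofFn c)) = ξ := funext (onList_ofFn ξ)
  have hdf : ∀ l, l.length = n + 2 + 1 → listD f l = 0 := by
    intro l hl
    match l, hl with
    | x :: y :: l, hl =>
      obtain ⟨z, hz⟩ := List.exists_ofFn_eq (m := n + 2) (quotients x (y :: l))
        (by simpa using hl)
      have h1 := β.multiplierRep.listD_homogeneous_delta hφ.restrict (onList u) x y l z hz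
      rw [hu', congrFun hu z] at h1
      rw [hf, h1]
      simp
  have hfX : ∀ k, ∀ l : List G, l.length = n + 2 → (∀ t ∈ l, t ∈ α.supp k) →
      f l k = listD (fun l => X l k) l := by
    intro k l hl hk
    match l, hl, hk with
    | x :: y :: l, hl, hk =>
      obtain ⟨z, hz⟩ := List.exists_ofFn_eq (m := n + 1) (quotients x (y :: l))
        (by simpa using hl)
      have hx : α.e x k = 1 := hk x (by simp)
      rw [hX, α.listD_homogeneous_delta_apply (onList ξ) x y l z hz hk, hξ', ← hξ,
        α.bracket_eTuple_mul_apply hx z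
          (fun t ht => hk t (by
            rw [hz, products_quotients] at ht; exact List.mem_cons_of_mem _ ht)),
        hφ.bracket_restrict, Pi.mul_apply, hx, one_mul, ← onList_ofFn u z, hz]
      rfl
  have hY := α.bracket_transfer hA (α.bracket_homogeneous_bracket (onList ξ))
    (α.bracket_homogeneous hF (onList u))
  rw [← hf, ← hX] at hY
  set Y := α.transfer X f with hYdef
  -- With the quotients `l` fixed and the base point `x` varying, equivariance of `Y` is exactly the
  -- compatibility that produces a multiplier.
  have hv : ∀ l : List G, ∃ v, ∀ x, hφ.restrict (β.multiplierRep x v) = Y (x :: products x l) :=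
    fun l => hφ.exists_multiplier (fun x => Y (x :: products x l)) fun g x => by
      rw [hY, List.map_cons, products_mul]
  choose V hV using hv
  have hVY : homogeneous F V = Y := by
    funext l
    cases l with
    | nil =>
      funext k
      simp [homogeneous, hYdef, UnitalPartialAction.transfer, hX, listPrism]
    | cons x l => exact (hV _ x).trans (by rw [products_quotients])
  refine ⟨fun c => V (List.ofFn c), funext fun z => hφ.multiplier_ext fun x => ?_⟩
  have hlen : (products x (List.ofFn z)).length = n + 1 := by simp
  obtain ⟨y, l, hyl⟩ := List.exists_cons_of_length_eq_add_one hlen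
  have hz : List.ofFn z = quotients x (y :: l) := by rw [← hyl, quotients_products]
  rw [← β.multiplierRep.listD_homogeneous_delta hφ.restrict V x y l z hz]
  change _ = listD (homogeneous F V) (x :: y :: l)
  rw [hVY]
  funext k
  rw [hYdef, α.listD_transfer_apply k hdf (hfX k) (x :: y :: l)
    (by rw [List.length_cons, ← hyl, hlen]), hf, ← onList_ofFn u z, hz]
  rfl

theorem eTuple_mul_restrict (hφ : IsEnvelopingAction α.toPartialAction β φ) {n : ℕ}
    {w : (Fin n → G) → ∀ l, A l} {u : (Fin n → G) → Multiplier K B}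
    (h : IsGlobalization α β φ w u) (z : Fin n → G) :
    α.eTuple z * hφ.restrict (u z) = w z := by
  apply hφ.injective
  rw [h.2, hφ.multiplier_map]

end IsEnvelopingAction

theorem Representation.delta_sub {K G M : Type*} [CommRing K] [Group G] [AddCommGroup M]
    [Module K M] (ρ : Representation K G M) (n : ℕ) (f g : (Fin n → G) → M) :
    ρ.delta n (f - g) = ρ.delta n f - ρ.delta n g := by
  funext x
  simp only [delta, Pi.sub_apply, map_sub, smul_sub, Finset.sum_sub_distrib]
  abel

theorem UnitalPartialAction.cohomologous_refl {K G A : Type*} [CommRing K] [Group G] [Ring A]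
    [Algebra K A] (α : UnitalPartialAction K G A) {n : ℕ} (w : (Fin (n + 1) → G) → A) :
    α.Cohomologous w w := by
  refine ⟨0, fun x => ⟨0, by simp⟩, ?_⟩
  funext x
  simp [delta, α.bracket_zero]

theorem mainTheorem3 {K G Λ B : Type*} {A : Λ → Type*} [CommRing K] [Group G]
    [∀ l, Ring (A l)] [∀ l, Algebra K (A l)] (hA : ∀ l, IsIndecomposableRing (A l))
    [NonUnitalRing B] [Module K B] [IsScalarTower K B B] [SMulCommClass K B B]
    (α : UnitalPartialAction K G (∀ l, A l)) (β : GlobalAction K G B)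
    (φ : (∀ l, A l) →ₙₐ[K] B) (hφ : IsEnvelopingAction α.toPartialAction β φ) (n : ℕ) :
    (∀ (w₁ w₂ : (Fin (n + 1) → G) → ∀ l, A l) (u₁ u₂ : (Fin (n + 1) → G) → Multiplier K B),
      α.IsCocycle w₁ → α.IsCocycle w₂ →
      IsGlobalization α β φ w₁ u₁ → IsGlobalization α β φ w₂ u₂ →
      α.Cohomologous w₁ w₂ → β.multiplierRep.Cohomologous u₁ u₂) ∧
    (∀ (w : (Fin (n + 1) → G) → ∀ l, A l) (u₁ u₂ : (Fin (n + 1) → G) → Multiplier K B),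
      α.IsCocycle w → IsGlobalization α β φ w u₁ → IsGlobalization α β φ w u₂ →
      β.multiplierRep.Cohomologous u₁ u₂) := by
  have key : ∀ (w₁ w₂ : (Fin (n + 1) → G) → ∀ l, A l)
      (u₁ u₂ : (Fin (n + 1) → G) → Multiplier K B),
      IsGlobalization α β φ w₁ u₁ → IsGlobalization α β φ w₂ u₂ →
      α.Cohomologous w₁ w₂ → β.multiplierRep.Cohomologous u₁ u₂ := by
    rintro w₁ w₂ u₁ u₂ h₁ h₂ ⟨ξ, -, hξ⟩
    obtain ⟨v, hv⟩ := hφ.exists_delta_eq hA (u₂ - u₁)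
      (by rw [Representation.IsCocycle, Representation.delta_sub, h₁.1, h₂.1, sub_zero]) ξ
      fun z => by
        rw [Pi.sub_apply, map_sub, mul_sub, hφ.eTuple_mul_restrict h₁, hφ.eTuple_mul_restrict h₂,
          hξ, Pi.add_apply, add_sub_cancel_left]
    exact ⟨v, by rw [← hv, add_sub_cancel]⟩
  exact ⟨fun w₁ w₂ u₁ u₂ _ _ => key w₁ w₂ u₁ u₂,
    fun w u₁ u₂ _ h₁ h₂ => key w w u₁ u₂ h₁ h₂ (α.cohomologous_refl w)⟩
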